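/- Let $0<s<1$ and $1<p<\infty$. A weight is a function $\omega\in L^1_{\mathrm{loc}}(\mathbb R^n)$ that is positive almost everywhere; it is an $A_p$ weight if there is $A>0$ such that for every cube $Q\subset\mathbb R^n$ $$\Big(\frac1{|Q|}\int_Q\omega\,dx\Big)\Big(\frac1{|Q|}\int_Q\omega^{-1/(p-1)}\,dx\Big)^{p-1}\le A .$$ For a weight $\omega$, let $W^{s,p,\omega}(\mathbb R^n)$ be the space of all $f\in L^p(\mathbb R^n)$ (real-valued) with $$\|f\|_{W^{s,p,\omega}(\mathbb R^n)}^p=\|f\|_{L^p(\mathbb R^n)}^p+\int_{\mathbb R^n}\int_{\mathbb R^n}\frac{|f(x)-f(y)|^p}{|x-y|^{sp}}\,\omega(x-y)\,dy\,dx<\infty ,$$ and for $E\subset\mathbb R^n$ let $$C_{s,p,\omega}(E)=\inf\big\{\|\varphi\|_{W^{s,p,\omega}(\mathbb R^n)}^p : \varphi\in W^{s,p,\omega}(\mathbb R^n),\ \varphi\ge1\text{ in an open set containing }E\big\},$$ with $\inf\emptyset=\infty$. Let $\omega$ be an $A_p$ weight in $\mathbb R^n$ such that $C_0^\infty(\mathbb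 R^n)\subset W^{s,p,\omega}(\mathbb R^n)$. Then $C_{s,p,\omega}(\{x\})>0$ for every $x\in\mathbb R^n$ if and only if $C_{s,p,\omega}(\{x\})>0$ for some $x\in\mathbb R^n$. If this is the case, then for every $f\in W^{s,p,\omega}(\mathbb R^n)$ the limit $$f^*(x)=\lim_{r\to0_+}\frac1{|B(x,r)|}\int_{B(x,r)}f(y)\,dy$$ exists in $\mathbb R$ for every $x\in\mathbb R^n$, the function $f^*:\mathbb R^n\to\mathbb R$ is continuous, and $f=f^*$ almost everywhere in $\mathbb R^n$. -/

import Mathlib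

open MeasureTheory Filter Topology
open scoped ENNReal

noncomputable section

namespace FracSobolev

/-- The space `ℝⁿ` with its Euclidean norm and Lebesgue measure. -/
abbrev Rn (n : ℕ) : Type := EuclideanSpace ℝ (Fin n)

/-- A weight: a locally integrable function that is positive almost everywhere. -/
def IsWeight {n : ℕ} (w : Rn n → ℝ) : Prop :=
  LocallyIntegrable w volume ∧ ∀ᵐ x ∂(volume : Measure (Rn n)), 0 < w x

/-- The (closed, axis-parallel) cube with corner `a` and side length `l`. -/
def cube {n : ℕ} (a : Rn n) (l : ℝ) : Set (Rn n) :=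
  {x | ∀ i, x i ∈ Set.Icc (a i) (a i + l)}

/-- The Muckenhoupt condition. The averages are taken in `[0, ∞]`, so that a non-integrable
power of the weight has average `∞`. -/
def IsMuckenhoupt {n : ℕ} (p : ℝ) (w : Rn n → ℝ) : Prop :=
  IsWeight w ∧ ∃ A : ℝ, 0 < A ∧ ∀ (a : Rn n) (l : ℝ), 0 < l →
    (⨍⁻ x in cube a l, ENNReal.ofReal (w x) ∂volume) *
      (⨍⁻ x in cube a l, ENNReal.ofReal (w x ^ (-1 / (p - 1))) ∂volume) ^ (p - 1)
        ≤ ENNReal.ofReal A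

/-- The `p`-th power of the fractional weighted Sobolev seminorm on `ℝⁿ`,
`∫∫ |f(x) - f(y)|ᵖ / |x - y|^{sp} w(x - y) dy dx`, with values in `[0, ∞]`. -/
def seminormPow {n : ℕ} (s p : ℝ) (w f : Rn n → ℝ) : ℝ≥0∞ :=
  ∫⁻ x : Rn n, ∫⁻ y : Rn n,
    ENNReal.ofReal (|f x - f y| ^ p / ‖x - y‖ ^ (s * p) * w (x - y))

/-- The `p`-th power of the fractional weighted Sobolev norm on `ℝⁿ`: the sum of the `p`-th powers
of the `Lᵖ` norm and of the seminorm. -/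
def normPow {n : ℕ} (s p : ℝ) (w f : Rn n → ℝ) : ℝ≥0∞ :=
  eLpNorm f (ENNReal.ofReal p) volume ^ p + seminormPow s p w f

/-- Membership in the fractional weighted Sobolev space `W^{s,p,w}(ℝⁿ)`. -/
def MemW {n : ℕ} (s p : ℝ) (w f : Rn n → ℝ) : Prop :=
  MemLp f (ENNReal.ofReal p) volume ∧ normPow s p w f < ∞

/-- The admissible functions for the capacity of `E`. -/
def admissible {n : ℕ} (s p : ℝ) (w : Rn n → ℝ) (E : Set (Rn n)) : Set (Rn n → ℝ) :=
  {φ | MemW s p w φ ∧ ∃ U : Set (Rn n), IsOpen U ∧ E ⊆ U ∧ ∀ x ∈ U, 1 ≤ φ x}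

/-- The Sobolev capacity; it is `∞` if there is no admissible function. -/
def capacity {n : ℕ} (s p : ℝ) (w : Rn n → ℝ) (E : Set (Rn n)) : ℝ≥0∞ :=
  ⨅ φ ∈ admissible s p w E, normPow s p w φ

end FracSobolev

end

namespace FracSobolev

variable {n : ℕ}

/-! ### Ball averages -/

/-! The substitution `y = x - z` turns the seminorm into an integral over `z` of `‖f - f(· - z)‖ₚᵖ`
against a fixed kernel (`seminormPow_eq`). The norm is therefore translation invariant, so all
points have the same capacity.

Averaging over balls commutes with translations, hence with each difference `f - f(· - z)`.
Convergence of averages in `Lᵖ` and dominated convergence in `z` show that the averages `f_r` tend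
to `f` in the Sobolev norm (`tendsto_normPow_ballAverage_sub`).

Each `f_r` is continuous, so `{|f_r - f_ρ| > t}` is open. If it contains a point, a multiple `±1/t`
of `f_r - f_ρ` is admissible there, and the capacity of that point times `tᵖ` is at most the norm
(`capacity_mul_le_normPow`). Positive capacity thus makes `f_r` uniformly Cauchy as `r → 0`. The
uniform limit is continuous, and Lebesgue differentiation identifies it with `f` almost everywhere.
-/

theorem locallyIntegrable_of_memLp {p : ℝ} (hp : 1 < p) {f : Rn n → ℝ}
    (hf : MemLp f (ENNReal.ofReal p) volume) : LocallyIntegrable f volume :=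
  hf.locallyIntegrable (by simpa using hp.le)

/-- Dominated convergence: for `y` off the null sphere around `x₀`, the indicator of the ball at `y`
is constant for centres near `x₀`. -/
theorem continuous_setIntegral_ball {f : Rn n → ℝ} (hf : LocallyIntegrable f volume) {r : ℝ}
    (hr : 0 < r) : Continuous fun x => ∫ y in Metric.ball x r, f y := by
  rw [continuous_iff_continuousAt]
  intro x₀
  simp_rw [← integral_indicator Metric.isOpen_ball.measurableSet]
  have hint : IntegrableOn f (Metric.closedBall x₀ (r + 1)) :=
    hf.integrableOn_isCompact (isCompact_closedBall _ _)
  refine continuousAt_of_dominated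
    (bound := (Metric.closedBall x₀ (r + 1)).indicator fun y => ‖f y‖) ?_ ?_ ?_ ?_
  · exact Eventually.of_forall fun x =>
      hf.aestronglyMeasurable.indicator Metric.isOpen_ball.measurableSet
  · filter_upwards [Metric.ball_mem_nhds x₀ one_pos] with x hx
    refine Eventually.of_forall fun y => ?_
    rw [norm_indicator_eq_indicator_norm]
    refine Set.indicator_le_indicator_of_subset ?_ (fun _ => norm_nonneg _) y
    refine (Metric.ball_subset_ball' ?_).trans Metric.ball_subset_closedBall
    linarith [Metric.mem_ball.1 hx]
  · exact (integrable_indicator_iff Metric.isClosed_closedBall.measurableSet).2 hint.norm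
  · have hs : ∀ᵐ y, y ∉ Metric.sphere x₀ r :=
      measure_eq_zero_iff_ae_notMem.1 (Measure.addHaar_sphere_of_ne_zero volume x₀ hr.ne')
    filter_upwards [hs] with y hy
    rcases lt_or_gt_of_ne (show dist y x₀ ≠ r from hy) with h | h
    · have : ∀ᶠ x in 𝓝 x₀, dist y x < r :=
        (continuous_const.dist continuous_id).continuousAt.eventually_lt continuousAt_const h
      refine (continuousAt_const (y := f y)).congr ?_
      filter_upwards [this] with x hx
      rw [Set.indicator_of_mem (Metric.mem_ball.2 hx)]
    · have : ∀ᶠ x in 𝓝 x₀, r < dist y x :=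
        continuousAt_const.eventually_lt (continuous_const.dist continuous_id).continuousAt h
      refine (continuousAt_const (y := (0 : ℝ))).congr ?_
      filter_upwards [this] with x hx
      rw [Set.indicator_of_notMem]
      simpa using hx.le

/-- The mean value of `f` over the ball of radius `r` around `x`. -/
noncomputable def ballAverage (f : Rn n → ℝ) (r : ℝ) (x : Rn n) : ℝ :=
  ⨍ y in Metric.ball x r, f y ∂volume

theorem continuous_ballAverage {f : Rn n → ℝ} (hf : LocallyIntegrable f volume) {r : ℝ}
    (hr : 0 < r) : Continuous (ballAverage f r) := by
  have : ballAverage f r = fun x => (volume.real (Metric.ball (0 : Rn n) r))⁻¹ •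
      ∫ y in Metric.ball x r, f y := by
    funext x
    rw [ballAverage, setAverage_eq, measureReal_def, measureReal_def, Measure.addHaar_ball_center]
  rw [this]
  exact (continuous_setIntegral_ball hf hr).const_smul (volume.real (Metric.ball 0 r))⁻¹

theorem ballAverage_eq (f : Rn n → ℝ) (r : ℝ) (x : Rn n) :
    ballAverage f r x = ⨍ h in Metric.ball (0 : Rn n) r, f (x + h) ∂volume := by
  rw [ballAverage, setAverage_eq, setAverage_eq, measureReal_def, measureReal_def,
    Measure.addHaar_ball_center]
  congr 1
  have h := (measurePreserving_add_left (volume : Measure (Rn n)) x).setIntegral_preimage_emb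
    (measurableEmbedding_addLeft x) f (Metric.ball x r)
  rw [← h, preimage_add_ball, sub_self]

theorem integrableOn_ball {f : Rn n → ℝ} (hf : LocallyIntegrable f volume) (x : Rn n) (r : ℝ) :
    IntegrableOn f (Metric.ball x r) :=
  (hf.integrableOn_isCompact (isCompact_closedBall x r)).mono_set Metric.ball_subset_closedBall

theorem integrableOn_ball_translate {f : Rn n → ℝ} (hf : LocallyIntegrable f volume) (x : Rn n)
    (r : ℝ) : IntegrableOn (fun h => f (x + h)) (Metric.ball 0 r) := by
  have h := (measurePreserving_add_left (volume : Measure (Rn n)) x).integrableOn_comp_preimage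
    (measurableEmbedding_addLeft x) (f := f) (s := Metric.ball x r)
  rw [preimage_add_ball, sub_self] at h
  exact h.2 (integrableOn_ball hf x r)

theorem ballAverage_sub_translate {f : Rn n → ℝ} (hf : LocallyIntegrable f volume) (r : ℝ)
    (z x : Rn n) : ballAverage (fun y => f y - f (y - z)) r x =
      ballAverage f r x - ballAverage f r (x - z) := by
  have h1 := integrableOn_ball_translate hf x r
  have h2 := integrableOn_ball_translate hf (x - z) r
  simp only [ballAverage_eq, setAverage_eq]
  rw [← smul_sub, ← integral_sub h1 h2]
  simp only [sub_add_eq_add_sub]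

theorem tendsto_ballAverage_ae {f : Rn n → ℝ} (hf : LocallyIntegrable f volume) :
    ∀ᵐ x, Tendsto (fun r => ballAverage f r x) (𝓝[>] 0) (𝓝 (f x)) := by
  filter_upwards [IsUnifLocDoublingMeasure.ae_tendsto_average volume hf 1] with x hx
  refine (hx (l := 𝓝[>] (0 : ℝ)) (fun _ => x) id tendsto_id ?_).congr' ?_
  · filter_upwards [self_mem_nhdsWithin] with r hr
    simpa using (Set.mem_Ioi.1 hr).le
  · filter_upwards [self_mem_nhdsWithin] with r hr
    -- The differentiation theorem uses closed balls; the bounding sphere is null.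
    refine setAverage_congr ?_
    rw [id, ← Metric.ball_union_sphere]
    exact union_ae_eq_left_of_ae_eq_empty (ae_eq_empty.2
      (Measure.addHaar_sphere_of_ne_zero volume x (Set.mem_Ioi.1 hr).ne'))

/-! ### Approximation by ball averages in `Lᵖ` -/

theorem eLpNorm_rpow {p : ℝ} (hp : 1 < p) (f : Rn n → ℝ) (μ : Measure (Rn n)) :
    eLpNorm f (ENNReal.ofReal p) μ ^ p = ∫⁻ x, ‖f x‖ₑ ^ p ∂μ := by
  have hp0 : 0 < p := by linarith
  rw [eLpNorm_eq_lintegral_rpow_enorm_toReal (by simpa using hp0) ENNReal.ofReal_ne_top,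
    ENNReal.toReal_ofReal hp0.le, ← ENNReal.rpow_mul, one_div_mul_cancel hp0.ne',
    ENNReal.rpow_one]

theorem enorm_sub_rpow_le {p : ℝ} (hp : 1 < p) (a b : ℝ) :
    ‖a - b‖ₑ ^ p ≤ 2 ^ (p - 1) * (‖a‖ₑ ^ p + ‖b‖ₑ ^ p) :=
  (ENNReal.rpow_le_rpow (enorm_sub_le) (by linarith)).trans
    (ENNReal.rpow_add_le_mul_rpow_add_rpow _ _ hp.le)

theorem lintegral_enorm_sub_rpow_le {p : ℝ} (hp : 1 < p) {f g : Rn n → ℝ}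
    (hf : AEStronglyMeasurable f volume) :
    ∫⁻ x, ‖f x - g x‖ₑ ^ p ≤ 2 ^ (p - 1) * ((∫⁻ x, ‖f x‖ₑ ^ p) + ∫⁻ x, ‖g x‖ₑ ^ p) := by
  rw [← lintegral_add_left' (hf.enorm.pow_const p), ← lintegral_const_mul' _ _ (by finiteness)]
  exact lintegral_mono fun x => enorm_sub_rpow_le hp _ _

theorem tendsto_lintegral_enorm_translate_sub {p : ℝ} (hp : 1 < p) {g : Rn n → ℝ}
    (hg : MemLp g (ENNReal.ofReal p) volume) :
    Tendsto (fun h => ∫⁻ x, ‖g (x + h) - g x‖ₑ ^ p) (𝓝 0) (𝓝 0) := by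
  have : Fact (1 ≤ ENNReal.ofReal p) := ⟨by simpa using hp.le⟩
  let T : C(Rn n, C(Rn n, Rn n)) :=
    (ContinuousMap.mk (fun a : Rn n × Rn n => a.2 + a.1) (by fun_prop)).curry
  have hT : ∀ h, MeasurePreserving (T h) volume volume := fun h =>
    measurePreserving_add_right volume h
  have hc : Continuous fun h => Lp.compMeasurePreserving (T h) (hT h) (hg.toLp g) :=
    continuous_const.compMeasurePreservingLp T.continuous hT ENNReal.ofReal_ne_top
  have h0 : ∀ h, edist (Lp.compMeasurePreserving (T h) (hT h) (hg.toLp g)) (hg.toLp g) ^ p =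
      ∫⁻ x, ‖g (x + h) - g x‖ₑ ^ p := by
    intro h
    rw [Lp.toLp_compMeasurePreserving hg (hT h), Lp.edist_toLp_toLp, eLpNorm_rpow hp]
    rfl
  have h1 : Lp.compMeasurePreserving (T 0) (hT 0) (hg.toLp g) = hg.toLp g := by
    rw [Lp.toLp_compMeasurePreserving hg (hT 0)]
    congr 1
    funext x
    simp [T]
  have h2 := (hc.edist (continuous_const (y := hg.toLp g))).tendsto 0
  rw [h1, edist_self] at h2
  have h3 := h2.ennrpow_const p
  rw [ENNReal.zero_rpow_of_pos (by linarith)] at h3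
  simpa only [h0] using h3

theorem lintegral_enorm_translate_sub_le {p : ℝ} (hp : 1 < p) {g : Rn n → ℝ}
    (hg : AEStronglyMeasurable g volume) (h : Rn n) :
    ∫⁻ x, ‖g (x + h) - g x‖ₑ ^ p ≤ 2 ^ (p - 1) * (2 * ∫⁻ x, ‖g x‖ₑ ^ p) := by
  refine (lintegral_enorm_sub_rpow_le hp
    (hg.comp_measurePreserving (measurePreserving_add_right volume h))).trans ?_
  simp only [Function.comp_apply]
  rw [lintegral_add_right_eq_self (fun x => ‖g x‖ₑ ^ p) h, two_mul]

theorem enorm_average_rpow_le {p : ℝ} (hp : 1 < p) (ν : Measure (Rn n)) [IsProbabilityMeasure ν]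
    {g : Rn n → ℝ} (hg : AEStronglyMeasurable g ν) :
    ‖∫ h, g h ∂ν‖ₑ ^ p ≤ ∫⁻ h, ‖g h‖ₑ ^ p ∂ν := by
  rw [← eLpNorm_rpow hp]
  refine ENNReal.rpow_le_rpow ?_ (by linarith)
  refine (enorm_integral_le_lintegral_enorm _).trans ?_
  rw [← eLpNorm_one_eq_lintegral_enorm]
  exact eLpNorm_le_eLpNorm_of_exponent_le (by simpa using hp.le) hg

/-- Jensen's inequality for the normalized measure `ν` on the ball, then Tonelli. -/
theorem lintegral_enorm_ballAverage_sub_le {p : ℝ} (hp : 1 < p) {g : Rn n → ℝ}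
    (hg : LocallyIntegrable g volume) {r : ℝ} (hr : 0 < r) :
    ∫⁻ x, ‖ballAverage g r x - g x‖ₑ ^ p ≤
      ⨍⁻ h in Metric.ball (0 : Rn n) r, ∫⁻ x, ‖g (x + h) - g x‖ₑ ^ p ∂volume ∂volume := by
  have hne : NeZero (volume.restrict (Metric.ball (0 : Rn n) r)) :=
    ⟨by simpa [Measure.restrict_eq_zero] using (Metric.measure_ball_pos volume _ hr).ne'⟩
  have hfin : IsFiniteMeasure (volume.restrict (Metric.ball (0 : Rn n) r)) :=
    isFiniteMeasure_restrict.2 measure_ball_lt_top.ne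
  set μ := volume.restrict (Metric.ball (0 : Rn n) r) with hμ
  set ν := (μ Set.univ)⁻¹ • μ with hν
  have hprob : IsProbabilityMeasure ν := isProbabilityMeasureSMul
  have hac : ν ≪ volume :=
    Measure.smul_absolutelyContinuous.trans Measure.restrict_le_self.absolutelyContinuous
  have hgm := hg.aestronglyMeasurable
  have hpt : ∀ x, ‖ballAverage g r x - g x‖ₑ ^ p ≤ ∫⁻ h, ‖g (x + h) - g x‖ₑ ^ p ∂ν := by
    intro x
    have hi : Integrable (fun h => g (x + h)) ν :=
      (integrableOn_ball_translate hg x r).smul_measure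
        (ENNReal.inv_ne_top.2 (NeZero.ne _))
    have : ballAverage g r x - g x = ∫ h, (g (x + h) - g x) ∂ν := by
      rw [integral_sub hi (integrable_const _), integral_const, probReal_univ, one_smul,
        ballAverage_eq]
      rfl
    rw [this]
    exact enorm_average_rpow_le hp ν (hi.aestronglyMeasurable.sub aestronglyMeasurable_const)
  refine (lintegral_mono hpt).trans (le_of_eq ?_)
  rw [lintegral_lintegral_swap]
  · rfl
  have hm : AEMeasurable (fun q : Rn n × Rn n => ‖g (q.1 + q.2) - g q.1‖ₑ ^ p)
      (volume.prod volume) :=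
    ((hgm.comp_quasiMeasurePreserving (quasiMeasurePreserving_add volume volume)).sub
      hgm.comp_fst).enorm.pow_const p
  exact hm.mono_ac (Measure.AbsolutelyContinuous.rfl.prod hac)

/-- The bound is independent of `r`, so it can serve as a dominating function. -/
theorem lintegral_enorm_ballAverage_sub_le_const {p : ℝ} (hp : 1 < p) {g : Rn n → ℝ}
    (hg : LocallyIntegrable g volume) {r : ℝ} (hr : 0 < r) :
    ∫⁻ x, ‖ballAverage g r x - g x‖ₑ ^ p ≤ 2 ^ (p - 1) * (2 * ∫⁻ x, ‖g x‖ₑ ^ p) := by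
  refine (lintegral_enorm_ballAverage_sub_le hp hg hr).trans ?_
  refine (lintegral_mono fun h =>
    lintegral_enorm_translate_sub_le hp hg.aestronglyMeasurable h).trans ?_
  exact (setLAverage_const (Metric.measure_ball_pos volume _ hr).ne' measure_ball_lt_top.ne _).le

theorem tendsto_lintegral_enorm_ballAverage_sub {p : ℝ} (hp : 1 < p) {g : Rn n → ℝ}
    (hg : MemLp g (ENNReal.ofReal p) volume) :
    Tendsto (fun r => ∫⁻ x, ‖ballAverage g r x - g x‖ₑ ^ p) (𝓝[>] 0) (𝓝 0) := by
  have hT := tendsto_lintegral_enorm_translate_sub hp hg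
  rw [ENNReal.tendsto_nhds_zero] at hT ⊢
  intro ε hε
  obtain ⟨δ, hδ, hball⟩ := Metric.eventually_nhds_iff_ball.1 (hT ε hε)
  filter_upwards [Ioo_mem_nhdsGT hδ] with r hr
  refine (lintegral_enorm_ballAverage_sub_le hp (locallyIntegrable_of_memLp hp hg) hr.1).trans ?_
  have : ∀ h ∈ Metric.ball (0 : Rn n) r, ∫⁻ x, ‖g (x + h) - g x‖ₑ ^ p ≤ ε := fun h hh =>
    hball h (Metric.ball_subset_ball hr.2.le hh)
  rw [setLAverage_eq]
  refine ENNReal.div_le_of_le_mul ?_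
  refine (setLIntegral_mono' Metric.isOpen_ball.measurableSet this).trans ?_
  rw [setLIntegral_const]

/-! ### The seminorm as an integral of translation differences -/

/-- The convolution kernel of the seminorm. -/
noncomputable def kernel (s p : ℝ) (w : Rn n → ℝ) (z : Rn n) : ℝ≥0∞ :=
  ENNReal.ofReal (w z / ‖z‖ ^ (s * p))

theorem aemeasurable_kernel (s p : ℝ) {w : Rn n → ℝ} (hw : LocallyIntegrable w volume) :
    AEMeasurable (kernel s p w) volume :=
  (hw.aestronglyMeasurable.aemeasurable.div
    (measurable_norm.pow_const (s * p)).aemeasurable).ennreal_ofReal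

theorem ofReal_integrand {s p : ℝ} (hp : 1 < p) (w : Rn n → ℝ) (a : ℝ) (z : Rn n) :
    ENNReal.ofReal (|a| ^ p / ‖z‖ ^ (s * p) * w z) = ‖a‖ₑ ^ p * kernel s p w z := by
  rw [kernel, div_mul_eq_mul_div, mul_div_assoc,
    ENNReal.ofReal_mul (Real.rpow_nonneg (abs_nonneg a) p),
    ← ENNReal.ofReal_rpow_of_nonneg (abs_nonneg a) (by linarith), Real.enorm_eq_ofReal_abs]

theorem seminormPow_eq {s p : ℝ} (hp : 1 < p) {w : Rn n → ℝ} (hw : LocallyIntegrable w volume)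
    {f : Rn n → ℝ} (hf : AEStronglyMeasurable f volume) :
    seminormPow s p w f = ∫⁻ z, (∫⁻ x, ‖f x - f (x - z)‖ₑ ^ p) * kernel s p w z := by
  have hm : AEMeasurable (fun q : Rn n × Rn n => ‖f q.1 - f (q.1 - q.2)‖ₑ ^ p)
      (volume.prod volume) :=
    (hf.comp_fst.sub (hf.comp_quasiMeasurePreserving
      (quasiMeasurePreserving_sub_of_right_invariant volume volume))).enorm.pow_const p
  have h1 : seminormPow s p w f =
      ∫⁻ x, ∫⁻ z, ‖f x - f (x - z)‖ₑ ^ p * kernel s p w z := by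
    refine lintegral_congr fun x => ?_
    simp only [ofReal_integrand hp]
    rw [← lintegral_sub_left_eq_self _ x]
    simp
  rw [h1, lintegral_lintegral_swap (hm.mul (aemeasurable_kernel s p hw).comp_snd)]
  refine lintegral_congr fun z => ?_
  exact lintegral_mul_const' _ _ ENNReal.ofReal_ne_top

theorem aemeasurable_lintegral_sub {p : ℝ} {f : Rn n → ℝ} (hf : AEStronglyMeasurable f volume) :
    AEMeasurable (fun z => ∫⁻ x, ‖f x - f (x - z)‖ₑ ^ p) volume := by
  have hm : AEMeasurable (fun q : Rn n × Rn n => ‖f q.1 - f (q.1 - q.2)‖ₑ ^ p)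
      (volume.prod volume) :=
    (hf.comp_fst.sub (hf.comp_quasiMeasurePreserving
      (quasiMeasurePreserving_sub_of_right_invariant volume volume))).enorm.pow_const p
  exact hm.prod_swap.lintegral_prod_right'

theorem normPow_eq {s p : ℝ} (hp : 1 < p) {w : Rn n → ℝ} (hw : LocallyIntegrable w volume)
    {f : Rn n → ℝ} (hf : AEStronglyMeasurable f volume) :
    normPow s p w f = (∫⁻ x, ‖f x‖ₑ ^ p) +
      ∫⁻ z, (∫⁻ x, ‖f x - f (x - z)‖ₑ ^ p) * kernel s p w z := by
  rw [normPow, eLpNorm_rpow hp, seminormPow_eq hp hw hf]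

theorem tendsto_normPow_ballAverage_sub {s p : ℝ} (hp : 1 < p) {w : Rn n → ℝ}
    (hw : LocallyIntegrable w volume) {f : Rn n → ℝ} (hf : MemW s p w f) :
    Tendsto (fun r => normPow s p w fun x => ballAverage f r x - f x) (𝓝[>] 0) (𝓝 0) := by
  have hfL := locallyIntegrable_of_memLp hp hf.1
  have hfm := hf.1.aestronglyMeasurable
  have hD : ∀ z, MemLp (fun y => f y - f (y - z)) (ENNReal.ofReal p) volume := fun z =>
    hf.1.sub (hf.1.comp_measurePreserving (measurePreserving_sub_right volume z))
  have hm : ∀ r, 0 < r → AEStronglyMeasurable (fun x => ballAverage f r x - f x) volume :=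
    fun r hr => (continuous_ballAverage hfL hr).aestronglyMeasurable.sub hfm
  have hfin : ∫⁻ z, (∫⁻ x, ‖f x - f (x - z)‖ₑ ^ p) * kernel s p w z ≠ ∞ := by
    rw [← seminormPow_eq hp hw hfm]
    exact (le_add_self.trans_lt hf.2).ne
  have hdiff : ∀ r z, (∫⁻ x, ‖ballAverage f r x - f x -
      (ballAverage f r (x - z) - f (x - z))‖ₑ ^ p) =
      ∫⁻ x, ‖ballAverage (fun y => f y - f (y - z)) r x - (f x - f (x - z))‖ₑ ^ p := by
    intro r z
    refine lintegral_congr fun x => ?_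
    rw [ballAverage_sub_translate hfL, sub_sub_sub_comm]
  have hlim : Tendsto (fun r => ∫⁻ z, (∫⁻ x, ‖ballAverage f r x - f x -
      (ballAverage f r (x - z) - f (x - z))‖ₑ ^ p) * kernel s p w z) (𝓝[>] 0)
      (𝓝 (∫⁻ _ : Rn n, 0)) := by
    refine tendsto_lintegral_filter_of_dominated_convergence'
      (fun z => 2 ^ (p - 1) * (2 * ((∫⁻ x, ‖f x - f (x - z)‖ₑ ^ p) * kernel s p w z))) ?_ ?_ ?_ ?_
    · filter_upwards [self_mem_nhdsWithin] with r hr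
      exact (aemeasurable_lintegral_sub (hm r hr)).mul (aemeasurable_kernel s p hw)
    · filter_upwards [self_mem_nhdsWithin] with r hr
      refine Eventually.of_forall fun z => ?_
      rw [hdiff, ← mul_assoc, ← mul_assoc, mul_assoc (2 ^ (p - 1))]
      gcongr
      exact lintegral_enorm_ballAverage_sub_le_const hp (locallyIntegrable_of_memLp hp (hD z)) hr
    · rw [lintegral_const_mul' _ _ (by finiteness), lintegral_const_mul' _ _ (by finiteness)]
      finiteness
    · refine Eventually.of_forall fun z => ?_
      -- For fixed `z` the kernel is a finite constant, so `Lᵖ` convergence of the averages of `f -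
      -- f(· - z)` suffices.
      have := ENNReal.Tendsto.mul_const (b := kernel s p w z)
        (tendsto_lintegral_enorm_ballAverage_sub hp (hD z)) (Or.inr ENNReal.ofReal_ne_top)
      simpa only [hdiff, zero_mul] using this
  rw [lintegral_zero] at hlim
  have h := (tendsto_lintegral_enorm_ballAverage_sub hp hf.1).add hlim
  rw [add_zero] at h
  refine h.congr' ?_
  filter_upwards [self_mem_nhdsWithin] with r hr
  rw [normPow_eq hp hw (hm r hr)]

/-! ### Elementary properties of the norm and the capacity -/

theorem normPow_sub_le {s p : ℝ} (hp : 1 < p) {w : Rn n → ℝ} (hw : LocallyIntegrable w volume)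
    {f g : Rn n → ℝ} (hf : AEStronglyMeasurable f volume) (hg : AEStronglyMeasurable g volume) :
    normPow s p w (fun x => f x - g x) ≤ 2 ^ (p - 1) * (normPow s p w f + normPow s p w g) := by
  rw [normPow_eq hp hw (f := fun x => f x - g x) (hf.sub hg), normPow_eq hp hw hf,
    normPow_eq hp hw hg, add_add_add_comm,
    mul_add]
  refine add_le_add (lintegral_enorm_sub_rpow_le hp hf) ?_
  have hm : AEMeasurable (fun z => (∫⁻ x, ‖f x - f (x - z)‖ₑ ^ p) * kernel s p w z) volume :=
    (aemeasurable_lintegral_sub hf).mul (aemeasurable_kernel s p hw)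
  rw [← lintegral_add_left' hm, ← lintegral_const_mul' _ _ (by finiteness)]
  refine lintegral_mono fun z => ?_
  rw [← add_mul, ← mul_assoc]
  refine mul_le_mul_left ?_ _
  simp only [sub_sub_sub_comm (f _) (g _)]
  exact lintegral_enorm_sub_rpow_le hp
    (hf.sub (hf.comp_measurePreserving (measurePreserving_sub_right volume z)))

theorem normPow_const_mul {s p : ℝ} (hp : 1 < p) {w : Rn n → ℝ} (hw : LocallyIntegrable w volume)
    {f : Rn n → ℝ} (hf : AEStronglyMeasurable f volume) (c : ℝ) :
    normPow s p w (fun x => c * f x) = ‖c‖ₑ ^ p * normPow s p w f := by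
  have hp0 : 0 ≤ p := by linarith
  have hc : ‖c‖ₑ ^ p ≠ ∞ := by finiteness
  rw [normPow_eq hp hw (hf.const_mul c), normPow_eq hp hw hf, mul_add]
  simp only [← mul_sub, enorm_mul, ENNReal.mul_rpow_of_nonneg _ _ hp0,
    lintegral_const_mul' _ _ hc, mul_assoc]

theorem normPow_translate {s p : ℝ} (hp : 1 < p) {w : Rn n → ℝ} (hw : LocallyIntegrable w volume)
    {f : Rn n → ℝ} (hf : AEStronglyMeasurable f volume) (a : Rn n) :
    normPow s p w (fun x => f (x + a)) = normPow s p w f := by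
  have hfa : AEStronglyMeasurable (fun x => f (x + a)) volume :=
    hf.comp_measurePreserving (measurePreserving_add_right volume a)
  rw [normPow_eq hp hw hfa, normPow_eq hp hw hf,
    lintegral_add_right_eq_self (fun x => ‖f x‖ₑ ^ p) a]
  congr 2
  funext z
  rw [← lintegral_add_right_eq_self (fun x => ‖f x - f (x - z)‖ₑ ^ p) a]
  simp only [sub_add_eq_add_sub]

theorem capacity_singleton_le {s p : ℝ} (hp : 1 < p) {w : Rn n → ℝ}
    (hw : LocallyIntegrable w volume) (x y : Rn n) :
    capacity s p w {x} ≤ capacity s p w {y} := by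
  refine le_iInf₂ fun φ hφ => ?_
  obtain ⟨⟨hLp, hfin⟩, U, hU, hyU, h1⟩ := hφ
  have hn := normPow_translate (s := s) hp hw hLp.aestronglyMeasurable (y - x)
  rw [← hn]
  refine iInf₂_le _ ⟨⟨hLp.comp_measurePreserving (measurePreserving_add_right volume (y - x)),
    hn.trans_lt hfin⟩, (fun z => z + (y - x)) ⁻¹' U, hU.preimage (by fun_prop), ?_, ?_⟩
  · simpa using hyU
  · exact fun z hz => h1 _ hz

/-- A capacitary Chebyshev inequality; continuity of `φ` supplies the open neighbourhood that
admissibility demands. -/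
theorem capacity_mul_le_normPow {s p : ℝ} (hp : 1 < p) {w : Rn n → ℝ}
    (hw : LocallyIntegrable w volume) {φ : Rn n → ℝ} (hφ : Continuous φ) {x : Rn n} {t : ℝ}
    (ht : 0 < t) (hx : t < |φ x|) :
    capacity s p w {x} * ENNReal.ofReal t ^ p ≤ normPow s p w φ := by
  have hp0 : 0 < p := by linarith
  obtain hfin | hfin := eq_or_ne (normPow s p w φ) ∞
  · simp [hfin]
  -- The sign of `c = ±t⁻¹` is chosen to match that of `φ x`.
  have key : ∀ c : ℝ, |c| = t⁻¹ → 1 < c * φ x →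
      capacity s p w {x} * ENNReal.ofReal t ^ p ≤ normPow s p w φ := by
    intro c hc h1
    have hn := normPow_const_mul (s := s) hp hw hφ.aestronglyMeasurable c
    have hct : ‖c‖ₑ ^ p * ENNReal.ofReal t ^ p = 1 := by
      rw [← ENNReal.mul_rpow_of_nonneg _ _ hp0.le, Real.enorm_eq_ofReal_abs, hc,
        ← ENNReal.ofReal_mul (by positivity), inv_mul_cancel₀ ht.ne']
      simp
    have hlt : normPow s p w (fun x => c * φ x) < ∞ := by
      rw [hn]; finiteness
    have hLp : MemLp (fun x => c * φ x) (ENNReal.ofReal p) volume := by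
      refine ⟨(hφ.const_mul c).aestronglyMeasurable, ?_⟩
      exact (ENNReal.rpow_lt_top_iff_of_pos hp0).1 (le_self_add.trans_lt hlt)
    have hle : capacity s p w {x} ≤ normPow s p w (fun x => c * φ x) := by
      refine iInf₂_le _ ⟨⟨hLp, hlt⟩, {z | 1 < c * φ z},
        isOpen_lt continuous_const (hφ.const_mul c), ?_, fun z hz => le_of_lt hz⟩
      simpa using h1
    calc capacity s p w {x} * ENNReal.ofReal t ^ p
        ≤ (‖c‖ₑ ^ p * normPow s p w φ) * ENNReal.ofReal t ^ p := by rw [← hn]; gcongr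
      _ = normPow s p w φ := by rw [mul_right_comm, hct, one_mul]
  rcases lt_abs.1 hx with h | h
  · refine key t⁻¹ (abs_of_pos (inv_pos.2 ht)) ?_
    rwa [inv_mul_eq_div, one_lt_div ht]
  · refine key (-t⁻¹) (by rw [abs_neg, abs_of_pos (inv_pos.2 ht)]) ?_
    rwa [neg_mul, ← mul_neg, inv_mul_eq_div, one_lt_div ht]

/-! ### Continuity of functions of finite norm -/

theorem uniformCauchySeqOn_ballAverage {s p : ℝ} (hp : 1 < p) {w : Rn n → ℝ}
    (hw : LocallyIntegrable w volume) (hcap : 0 < capacity s p w {(0 : Rn n)}) {f : Rn n → ℝ}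
    (hf : MemW s p w f) :
    UniformCauchySeqOn (ballAverage f) (𝓝[>] 0) Set.univ := by
  have hfL := locallyIntegrable_of_memLp hp hf.1
  have hfm := hf.1.aestronglyMeasurable
  have hN := tendsto_normPow_ballAverage_sub hp hw hf
  have hN2 := ENNReal.Tendsto.const_mul (a := (2 : ℝ≥0∞) ^ (p - 1))
    ((hN.comp tendsto_fst).add (hN.comp tendsto_snd)) (Or.inr (by finiteness))
  rw [add_zero, mul_zero] at hN2
  intro u hu
  obtain ⟨ε, hε, hεu⟩ := Metric.mem_uniformity_dist.1 hu
  -- The level is `ε / 2` because negating `dist < ε` gives only `≥ ε`, while the capacity estimate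
  -- needs a strict inequality.
  have hpos : 0 < capacity s p w {(0 : Rn n)} * ENNReal.ofReal (ε / 2) ^ p :=
    ENNReal.mul_pos hcap.ne' (ENNReal.rpow_pos (by simpa using hε) ENNReal.ofReal_ne_top).ne'
  have hr : ∀ᶠ r : ℝ in 𝓝[>] 0, 0 < r := self_mem_nhdsWithin
  filter_upwards [hN2.eventually_lt_const hpos, hr.prod_mk hr] with q hq hq0 x _
  refine hεu ?_
  by_contra! hge
  rw [Real.dist_eq] at hge
  have h1 := continuous_ballAverage hfL hq0.1
  have h2 := continuous_ballAverage hfL hq0.2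
  have hle := capacity_mul_le_normPow (s := s) hp hw (h1.sub h2) (x := x) (half_pos hε)
    (show ε / 2 < |ballAverage f q.1 x - ballAverage f q.2 x| by linarith)
  have hsub := normPow_sub_le (s := s) hp hw (h1.aestronglyMeasurable.sub hfm)
    (h2.aestronglyMeasurable.sub hfm)
  -- The difference of two averages is `(f_r - f) - (f_ρ - f)`, whose norm is controlled by two
  -- small terms.
  simp only [Pi.sub_apply, sub_sub_sub_cancel_right] at hsub
  refine absurd hq (not_lt.2 ?_)
  refine (mul_le_mul_left (capacity_singleton_le hp hw 0 x) _).trans (hle.trans hsub)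

end FracSobolev

theorem mainTheorem9 (n : ℕ) (s p : ℝ) (hs0 : 0 < s) (hs1 : s < 1) (hp : 1 < p)
    (w : FracSobolev.Rn n → ℝ) (hw : FracSobolev.IsMuckenhoupt p w)
    (hsub : ∀ φ : FracSobolev.Rn n → ℝ, ContDiff ℝ (⊤ : ℕ∞) φ → HasCompactSupport φ →
      FracSobolev.MemW s p w φ) :
    ((∀ x, 0 < FracSobolev.capacity s p w {x}) ↔
      ∃ x, 0 < FracSobolev.capacity s p w {x}) ∧
    ((∀ x, 0 < FracSobolev.capacity s p w {x}) →
      ∀ f : FracSobolev.Rn n → ℝ, FracSobolev.MemW s p w f →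
        ∃ fstar : FracSobolev.Rn n → ℝ,
          (∀ x, Tendsto (fun r : ℝ => ⨍ y in Metric.ball x r, f y ∂volume)
            (𝓝[>] 0) (𝓝 (fstar x))) ∧
          Continuous fstar ∧
          f =ᵐ[volume] fstar) := by
  have hwL := hw.1.1
  refine ⟨⟨fun h => ⟨0, h 0⟩, fun ⟨x, hx⟩ y =>
    hx.trans_le (FracSobolev.capacity_singleton_le hp hwL x y)⟩, fun hcap f hf => ?_⟩
  have hfL := FracSobolev.locallyIntegrable_of_memLp hp hf.1
  have hC := FracSobolev.uniformCauchySeqOn_ballAverage hp hwL (hcap 0) hf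
  have hlim : ∀ x, ∃ l, Tendsto (fun r => FracSobolev.ballAverage f r x) (𝓝[>] 0) (𝓝 l) :=
    fun x => cauchy_map_iff_exists_tendsto.1 (hC.cauchy_map (Set.mem_univ x))
  choose fstar hstar using hlim
  refine ⟨fstar, hstar, ?_, ?_⟩
  · have hU := hC.tendstoUniformlyOn_of_tendsto fun x _ => hstar x
    rw [tendstoUniformlyOn_univ] at hU
    refine hU.continuous (Eventually.frequently ?_)
    filter_upwards [self_mem_nhdsWithin] with r hr
    exact FracSobolev.continuous_ballAverage hfL hr
  · filter_upwards [FracSobolev.tendsto_ballAverage_ae hfL] with x hx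
    exact tendsto_nhds_unique hx (hstar x)
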